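/- Let $d\ge 3$ and $2\le r\le d-1$, and let $n_1,\dots,n_r$ be positive integers. For each $1\le i\le r$ let $0<\alpha_{i,1}<\alpha_{i,2}<\dots<\alpha_{i,n_i}$ be real numbers, and let $\nu_1>\nu_2>\dots>\nu_r=0$ be integers. For $1\le i\le r$ let $\gamma_i(t)\in\mathbb{R}^d$ be the point whose $i$-th coordinate is $t$, whose other coordinates among the first $r$ are $0$, and whose last $d-r$ coordinates are $t^2,t^3,\dots,t^{d-r+1}$. (Thus $\gamma_i$ is the $(d-r+1)$-dimensional moment curve embedded in the flat $F_i=\{x\in\mathbb{R}^d : x_j=0 \text{ for } 1\le j\le r,\ j\ne i\}$.) For $\tau>0$ put $$U_i=\{\gamma_i(\alpha_{i,j}\tau^{\nu_i}) : 1\le j\le n_i\},\qquad Q_i=\operatorname{conv}(U_i).$$ Let $e_0=0$ and let $e_1,\dots,e_{r-1}$ be the standard basis of $\mathbb{R}^{r-1}$. Let $U_i'=\{e_{i-1}\}\times U_i\subset\mathbb{R}^{r-1}\times\mathbb{R}^d$ and $U'=U_1'\cup\dots\cup U_r'$, and let $\mathcal{Q}=\operatorname{conv}(U')$ be the Cayley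 polytope of $Q_1,\dots,Q_r$. Let $\mathcal{W}_{\mathcal{Q}}$ be the set of faces of $\mathcal{Q}$ (the trivial face $\mathcal{Q}$ included) that meet the flat $\overline{W}=\{\frac1r(e_0+e_1+\dots+e_{r-1})\}\times\mathbb{R}^d$, and let $f_{k-1}(\mathcal{W}_{\mathcal{Q}})$ be the number of its $(k-1)$-dimensional members. Call $S\subseteq U'$ spanning if $S\cap U_i'\neq\emptyset$ for all $1\le i\le r$. Then there is $\tau^\star>0$ such that for every $\tau$ with $0<\tau\le\tau^\star$ (in particular for $\tau=\tau^\star$) and every integer $k$ with $r\le k\le\lfloor\frac{d+r-1}{2}\rfloor$: every spanning subset of $U'$ of size $k$ is the vertex set of a $(k-1)$-dimensional face of $\mathcal{Q}$, and $$f_{k-1}(\mathcal{W}_{\mathcal{Q}})=\Phi_k(n_1,\dots,n_r):=\sum_{\substack{1\le s_i\le n_i\\ s_1+\dots+s_r=k}}\ \prod_{i=1}^r\binom{n_i}{s_i}.$$ -/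

import Mathlib

namespace CayleySum

noncomputable section

/-- The ambient space `ℝ^(r-1) × ℝ^d` of the Cayley embedding of `r` subsets of `ℝ^d`. -/
abbrev Ambient (r d : ℕ) : Type := (Fin (r - 1) → ℝ) × (Fin d → ℝ)

/-- The affine basis `e_0 = 0, e_1, …, e_(r-1)` of `ℝ^(r-1)`, where `e_1, …, e_(r-1)` is the
standard basis. -/
def affBasis (r : ℕ) (i : Fin r) : Fin (r - 1) → ℝ :=
  fun m => if (m : ℕ) + 1 = (i : ℕ) then 1 else 0

/-- The `i`-th affine inclusion `x ↦ (e_i, x)`; indices start at `0`. -/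
def cayleyIncl {r d : ℕ} (i : Fin r) (x : Fin d → ℝ) : Ambient r d := (affBasis r i, x)

/-- The Cayley embedding of the point sets `V_i`: the union of the sets `{e_i} × V_i`. -/
def cayleyEmbedding {r d : ℕ} (V : Fin r → Set (Fin d → ℝ)) : Set (Ambient r d) :=
  ⋃ i, cayleyIncl i '' V i

/-- The Cayley polytope of the polytopes `conv V_i`. -/
def cayleyPolytope {r d : ℕ} (V : Fin r → Set (Fin d → ℝ)) : Set (Ambient r d) :=
  convexHull ℝ (cayleyEmbedding V)

/-- The `d`-flat `{(1/r) e_0 + ⋯ + (1/r) e_(r-1)} × ℝ^d`. -/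
def avgFlat (r d : ℕ) : Set (Ambient r d) :=
  {p | p.1 = ∑ i : Fin r, (1 / (r : ℝ)) • affBasis r i}

/-- `F` is a nonempty face of `P`: the set of all points of `P` at which some linear functional
attains its maximum over `P` (the zero functional gives `P` itself, the trivial face). -/
def IsFace {r d : ℕ} (P F : Set (Ambient r d)) : Prop := IsExposed ℝ P F ∧ F.Nonempty

/-- The dimension of the affine hull of a (nonempty) set. -/
def faceDim {r d : ℕ} (F : Set (Ambient r d)) : ℕ :=
  Module.finrank ℝ (affineSpan ℝ F).direction

/-- The vertices of `P`: the points `x` such that `{x}` is a face of `P`. -/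
def vertexSet {r d : ℕ} (P : Set (Ambient r d)) : Set (Ambient r d) := {x | IsFace P {x}}

/-- The faces of the polytope `P` that meet the flat `avgFlat r d`. -/
def flatFaces {r d : ℕ} (P : Set (Ambient r d)) : Set (Set (Ambient r d)) :=
  {F | IsFace P F ∧ (F ∩ avgFlat r d).Nonempty}

/-- The number of `m`-dimensional members of a set `𝓕` of faces (`⊤` if there are infinitely
many). -/
def faceNumber {r d : ℕ} (𝓕 : Set (Set (Ambient r d))) (m : ℕ) : ℕ∞ :=
  {F ∈ 𝓕 | faceDim F = m}.encard

/-- `S` is a spanning subset of the Cayley embedding of the `V_i`, with respect to its partition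
into the sets `{e_i} × V_i`: it meets all of these. -/
def IsSpanning {r d : ℕ} (V : Fin r → Set (Fin d → ℝ)) (S : Set (Ambient r d)) : Prop :=
  S ⊆ cayleyEmbedding V ∧ ∀ i, (S ∩ cayleyIncl i '' V i).Nonempty

/-- The `(d-r+1)`-dimensional moment curve `t ↦ (t, t², …, t^(d-r+1))` in the flat
`{x | x_j = 0 for j < r, j ≠ i}` of `ℝ^d` (coordinates are numbered from `0`): the `i`-th
coordinate is `t`, and the last `d - r` coordinates are `t², …, t^(d-r+1)`. -/
def momentCurve {r : ℕ} (d : ℕ) (i : Fin r) (t : ℝ) : Fin d → ℝ :=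
  fun j => if (j : ℕ) < r then (if (j : ℕ) = (i : ℕ) then t else 0) else t ^ ((j : ℕ) - r + 2)

/-- The vertices `γ_i (α_(i,j) τ^(ν_i))`, `1 ≤ j ≤ n_i`, of the cyclic polytope `Q_i`. -/
def cyclicPoints {r : ℕ} (d : ℕ) (n : Fin r → ℕ) (α : (i : Fin r) → Fin (n i) → ℝ)
    (ν : Fin r → ℕ) (τ : ℝ) (i : Fin r) : Set (Fin d → ℝ) :=
  Set.range fun j : Fin (n i) => momentCurve d i (α i j * τ ^ ν i)

/-- `Φ_ℓ(n_1, …, n_r)`: the sum of `∏ i, (n_i choose s_i)` over all `s` with `1 ≤ s_i ≤ n_i` and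
`s_1 + ⋯ + s_r = ℓ`. -/
def spanCount {r : ℕ} (n : Fin r → ℕ) (ℓ : ℕ) : ℕ :=
  ∑ s ∈ (Fintype.piFinset fun i => Finset.Icc 1 (n i)) with ∑ i, s i = ℓ,
    ∏ i, (n i).choose (s i)

end

end CayleySum

/-! Linear functionals realise on the `i`-th block of Cayley points, up to one common constant, any
values `P_i(t) = l_i + m_i t + q(t)`. The numbers `l_i`, `m_i` are free for each block, and `q` is
common to all blocks, without constant or linear term and of degree at most `d - r + 1`. A spanning
set of size `k` therefore gives a face once some such `P_i` vanish at its parameters and are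
positive at all others.

Requiring double zeros gives `2k` linear equations. With `deg q ≤ N + 2` and `N = 2k - 2r` there are
`2k + 1` unknowns, so a nonzero solution exists; the bound on `k` says exactly that `N + 2 ≤ d - r +
1`. All `P_i` have the same second derivative `w = q''`, of degree at most `N`. If a block contains
`s_i` double zeros, Rolle's theorem gives `2 s_i - 2` zeros of `w` in its parameter interval. For
small `τ` these intervals are disjoint, so the zeros number `N` and there are no others. Hence no
`P_i` has a further zero in its interval, and the even count in each block gives all `P_i` the same
sign (`Polynomial.exists_vanish_pos`).

The same functionals show that spanning sets of size up to `k + 1` are affinely independent. So a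
`(k-1)`-face meeting the flat has exactly `k` vertices, and counting faces amounts to counting
spanning sets. -/

/-! ### Polynomials with a common second derivative -/

open Polynomial in
/-- Rolle's theorem for finite sets of zeros. -/
theorem Polynomial.exists_finset_derivative_zeros (f : ℝ[X]) (A : Finset ℝ) (hA : A.Nonempty)
    (h : ∀ a ∈ A, f.eval a = 0) :
    ∃ B : Finset ℝ, B.card + 1 = A.card ∧ Disjoint A B ∧
      ∀ b ∈ B, f.derivative.eval b = 0 ∧ (∃ a ∈ A, a < b) ∧ ∃ a ∈ A, b < a := by
  induction A using Finset.induction_on_max with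
  | empty => simp at hA
  | insert x A hx ih =>
    rcases A.eq_empty_or_nonempty with rfl | hne
    · exact ⟨∅, by simp⟩
    obtain ⟨B, hcard, hdisj, hB⟩ := ih hne fun a ha => h a (Finset.mem_insert_of_mem ha)
    set m := A.max' hne
    have hm : m ∈ A := A.max'_mem hne
    obtain ⟨c, hc, hc0⟩ := exists_hasDerivAt_eq_zero (f := fun t => f.eval t)
      (f' := fun t => f.derivative.eval t) (hx m hm) f.continuous.continuousOn
      (by rw [h m (Finset.mem_insert_of_mem hm), h x (Finset.mem_insert_self _ _)])
      (fun t _ => f.hasDerivAt t)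
    have hle : ∀ a ∈ A, a ≤ m := fun a ha => A.le_max' a ha
    have hBc : ∀ b ∈ B, b < c := fun b hb => by
      obtain ⟨-, -, a, ha, hba⟩ := hB b hb
      exact hba.trans_le ((hle a ha).trans hc.1.le)
    have hcB : c ∉ B := fun hcB => lt_irrefl _ (hBc c hcB)
    refine ⟨insert c B, ?_, ?_, ?_⟩
    · rw [Finset.card_insert_of_notMem hcB, hcard,
        Finset.card_insert_of_notMem fun hxA => lt_irrefl _ (hx x hxA)]
    · simp only [Finset.disjoint_insert_left, Finset.disjoint_insert_right, Finset.mem_insert,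
        not_or]
      exact ⟨⟨hc.2.ne, fun hcA => (hc.1.trans_le (hle c hcA)).false⟩,
        fun hxB => (hc.2.trans (hBc x hxB)).false, hdisj⟩
    · intro b hb
      rcases Finset.mem_insert.1 hb with rfl | hb
      · exact ⟨hc0, ⟨m, Finset.mem_insert_of_mem hm, hc.1⟩, x, Finset.mem_insert_self _ _, hc.2⟩
      · obtain ⟨h0, ⟨a, ha, hab⟩, a', ha', hab'⟩ := hB b hb
        exact ⟨h0, ⟨a, Finset.mem_insert_of_mem ha, hab⟩, a', Finset.mem_insert_of_mem ha', hab'⟩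

open Polynomial in
/-- Rolle's theorem for the second derivative, counting the zeros in `T` twice. -/
theorem Polynomial.exists_finset_derivative_derivative_zeros (f : ℝ[X]) (T A : Finset ℝ)
    (hT : T.Nonempty) (hTA : T ⊆ A) (hA : ∀ a ∈ A, f.eval a = 0)
    (hT' : ∀ a ∈ T, f.derivative.eval a = 0) :
    ∃ B : Finset ℝ, B.card + 2 = A.card + T.card ∧ Disjoint T B ∧
      ∀ b ∈ B, f.derivative.derivative.eval b = 0 ∧ (∃ a ∈ A, a < b) ∧ ∃ a ∈ A, b < a := by
  obtain ⟨B, hcard, hdisj, hB⟩ := f.exists_finset_derivative_zeros A (hT.mono hTA) hA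
  obtain ⟨B', hcard', hdisj', hB'⟩ := f.derivative.exists_finset_derivative_zeros (T ∪ B)
    (hT.mono Finset.subset_union_left) (by
      intro a ha
      rcases Finset.mem_union.1 ha with ha | ha
      exacts [hT' a ha, (hB a ha).1])
  -- The Rolle zeros avoid `A ⊇ T`, so `f'` has `|T| + |A| - 1` distinct zeros.
  rw [Finset.card_union_of_disjoint (hdisj.mono_left hTA)] at hcard'
  refine ⟨B', by omega, hdisj'.mono_left Finset.subset_union_left, fun b hb => ?_⟩
  obtain ⟨h0, ⟨a, ha, hab⟩, a', ha', hab'⟩ := hB' b hb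
  refine ⟨h0, ?_, ?_⟩
  · rcases Finset.mem_union.1 ha with ha | ha
    · exact ⟨a, hTA ha, hab⟩
    · obtain ⟨-, ⟨e, he, hea⟩, -⟩ := hB a ha
      exact ⟨e, he, hea.trans hab⟩
  · rcases Finset.mem_union.1 ha' with ha | ha
    · exact ⟨a', hTA ha, hab'⟩
    · obtain ⟨-, -, e, he, hea⟩ := hB a' ha
      exact ⟨e, he, hab'.trans hea⟩

open Polynomial in
theorem Polynomial.card_biUnion_zeros_and_subset_roots {ι : Type*} [Fintype ι] [LinearOrder ι] (w : ℝ[X])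
    (hw : w ≠ 0) (J : ι → Set ℝ) (hJ : ∀ i j, i < j → ∀ x ∈ J i, ∀ y ∈ J j, x < y)
    (B : ι → Finset ℝ) (hB : ∀ i, ∀ b ∈ B i, w.eval b = 0 ∧ b ∈ J i) :
    (Finset.univ.biUnion B).card = ∑ i, (B i).card ∧ Finset.univ.biUnion B ⊆ w.roots.toFinset := by
  constructor
  · refine Finset.card_biUnion fun i _ j _ hij => Finset.disjoint_left.2 fun x hxi hxj => ?_
    rcases lt_or_gt_of_ne hij with h | h
    · exact (hJ i j h x (hB i x hxi).2 x (hB j x hxj).2).false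
    · exact (hJ j i h x (hB j x hxj).2 x (hB i x hxi).2).false
  · intro x hx
    obtain ⟨i, -, hi⟩ := Finset.mem_biUnion.1 hx
    simpa [hw] using (hB i x hi).1

open Polynomial in
/-- Over the zeros of an even number of factors in each of several separated sets, the sign at
a point `a` above all the zeros in its own set is that of the leading coefficient. -/
theorem Polynomial.eval_mul_leadingCoeff_pos {ι : Type*} [Fintype ι] [LinearOrder ι] (w : ℝ[X])
    (hw : w ≠ 0) (J : ι → Set ℝ) (hJ : ∀ i j, i < j → ∀ x ∈ J i, ∀ y ∈ J j, x < y)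
    (B : ι → Finset ℝ) (hB : ∀ i, ∀ b ∈ B i, w.eval b = 0 ∧ b ∈ J i)
    (hdeg : w.natDegree ≤ ∑ i, (B i).card) (heven : ∀ i, Even (B i).card)
    (i : ι) (a : ℝ) (ha : a ∈ J i) (haB : ∀ b ∈ B i, b < a) :
    0 < w.eval a * w.leadingCoeff := by
  obtain ⟨hcard, hsub⟩ := w.card_biUnion_zeros_and_subset_roots hw J hJ B hB
  have hle : (Finset.univ.biUnion B).val ≤ w.roots :=
    (Finset.val_le_iff_val_subset.2 fun x hx => by simpa using hsub hx)
  -- The given zeros already number at least the degree, so they are all the roots, each simple, and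
  -- `w` splits.
  have hroots : (Finset.univ.biUnion B).val = w.roots := by
    refine Multiset.eq_of_le_of_card_le hle ?_
    rw [Finset.card_val, hcard]
    exact (card_roots' w).trans hdeg
  have hsplit := C_leadingCoeff_mul_prod_multiset_X_sub_C (p := w) (by
    rw [← hroots, Finset.card_val, hcard]
    refine le_antisymm ?_ hdeg
    rw [← hcard, ← Finset.card_val]
    exact (Multiset.card_le_card hle).trans (card_roots' w))
  have hprod : w = C w.leadingCoeff * ∏ i, ∏ b ∈ B i, (X - C b) := by
    conv_lhs => rw [← hsplit, ← hroots]
    congr 1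
    rw [← Finset.prod_biUnion]
    · rfl
    refine fun i _ j _ hij => Finset.disjoint_left.2 fun x hxi hxj => ?_
    rcases lt_or_gt_of_ne hij with h | h
    · exact (hJ i j h x (hB i x hxi).2 x (hB j x hxj).2).false
    · exact (hJ j i h x (hB j x hxj).2 x (hB i x hxi).2).false
  have hev : w.eval a = w.leadingCoeff * ∏ i, ∏ b ∈ B i, (a - b) := by
    conv_lhs => rw [hprod]
    simp [eval_prod]
  have hlc : w.leadingCoeff ≠ 0 := leadingCoeff_ne_zero.2 hw
  have hpos : 0 < ∏ i, ∏ b ∈ B i, (a - b) := by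
    refine Finset.prod_pos fun j _ => ?_
    rcases lt_trichotomy i j with h | rfl | h
    -- All zeros in a higher block give negative factors, but their number is even.
    · have : ∏ b ∈ B j, (a - b) = ∏ b ∈ B j, (b - a) := by
        rw [← one_mul (∏ b ∈ B j, (b - a)), ← (heven j).neg_one_pow, ← Finset.prod_const,
          ← Finset.prod_mul_distrib]
        exact Finset.prod_congr rfl fun b _ => by ring
      rw [this]
      exact Finset.prod_pos fun b hb => sub_pos.2 (hJ i j h a ha b (hB j b hb).2)
    · exact Finset.prod_pos fun b hb => sub_pos.2 (haB b hb)
    · exact Finset.prod_pos fun b hb => sub_pos.2 (hJ j i h b (hB j b hb).2 a ha)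
  rw [hev, mul_right_comm]
  exact mul_pos (mul_self_pos.2 hlc) hpos

open Polynomial in
theorem Polynomial.exists_eq_prod_sq_mul (f : ℝ[X]) (T : Finset ℝ)
    (h : ∀ a ∈ T, f.eval a = 0) (h' : ∀ a ∈ T, f.derivative.eval a = 0) :
    ∃ R : ℝ[X], f = (∏ a ∈ T, (X - C a) ^ 2) * R := by
  rcases eq_or_ne f 0 with rfl | hf
  · exact ⟨0, by simp⟩
  refine Finset.prod_dvd_of_coprime (fun a _ b _ hab => ?_) fun a ha => ?_
  · exact (pairwise_coprime_X_sub_C Function.injective_id hab).pow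
  · refine (pow_dvd_pow _ ?_).trans (pow_rootMultiplicity_dvd f a)
    exact (one_lt_rootMultiplicity_iff_isRoot hf).2 ⟨h a ha, h' a ha⟩

open Polynomial in
theorem Polynomial.eval_derivative_derivative_sq_mul (a : ℝ) (H : ℝ[X]) :
    ((X - C a) ^ 2 * H).derivative.derivative.eval a = 2 * H.eval a := by
  simp only [derivative_mul, sq, derivative_add, derivative_sub, derivative_X, derivative_C, eval_add,
    eval_mul, eval_sub, eval_X, eval_C, eval_one, eval_zero, derivative_one, sub_zero]
  ring

open Polynomial in
/-- A common polynomial `q` without constant and linear terms, together with affine corrections,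
such that each `C (l i) + C (m i) * X + q` vanishes doubly at the points of `T i`. -/
theorem Polynomial.exists_double_zeros {ι : Type*} [Fintype ι] (T : ι → Finset ℝ) (N : ℕ)
    (hN : ∑ i, 2 * (T i).card = 2 * Fintype.card ι + N) :
    ∃ (l m : ι → ℝ) (q : ℝ[X]), ¬ (l = 0 ∧ m = 0 ∧ q = 0) ∧ q.natDegree ≤ N + 2 ∧
      q.coeff 0 = 0 ∧ q.coeff 1 = 0 ∧
      ∀ i, ∀ t ∈ T i, (C (l i) + C (m i) * X + q).eval t = 0 ∧
        (C (l i) + C (m i) * X + q).derivative.eval t = 0 := by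
  let Q : (Fin (N + 1) → ℝ) →ₗ[ℝ] ℝ[X] :=
    ∑ e : Fin (N + 1), (monomial ((e : ℕ) + 2)).comp (LinearMap.proj e)
  have hQ : ∀ c, Q c = ∑ e : Fin (N + 1), monomial ((e : ℕ) + 2) (c e) := fun c => by simp [Q]
  let P (i : ι) : ((ι → ℝ) × (ι → ℝ) × (Fin (N + 1) → ℝ)) →ₗ[ℝ] ℝ[X] :=
    (monomial 0).comp ((LinearMap.proj i).comp (LinearMap.fst ℝ _ _)) +
    (monomial 1).comp ((LinearMap.proj i).comp ((LinearMap.fst ℝ _ _).comp (LinearMap.snd ℝ _ _))) +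
    Q.comp ((LinearMap.snd ℝ _ _).comp (LinearMap.snd ℝ _ _))
  have hP : ∀ i v, P i v = C (v.1 i) + C (v.2.1 i) * X + Q v.2.2 := fun i v => by
    simp [P, C_mul_X_eq_monomial]
  let E : ((ι → ℝ) × (ι → ℝ) × (Fin (N + 1) → ℝ)) →ₗ[ℝ] (((i : ι) × T i) → ℝ × ℝ) :=
    LinearMap.pi fun x => ((leval (x.2 : ℝ)).comp (P x.1)).prod
      ((leval (x.2 : ℝ)).comp (derivative.comp (P x.1)))
  -- There are `2|ι| + N + 1` unknowns and `2|ι| + N` equations.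
  have hker : LinearMap.ker E ≠ ⊥ := by
    apply LinearMap.ker_ne_bot_of_finrank_lt
    simp only [Module.finrank_prod, Module.finrank_fintype_fun_eq_card, Module.finrank_pi_fintype,
      Module.finrank_self, Finset.sum_const, Finset.card_univ, Fintype.card_sigma, Fintype.card_coe,
      Fintype.card_fin, smul_eq_mul]
    rw [← Finset.mul_sum] at hN
    omega
  obtain ⟨v, hv, hv0⟩ := Submodule.exists_mem_ne_zero_of_ne_bot hker
  have hcoeff : ∀ (c : Fin (N + 1) → ℝ) (e : Fin (N + 1)), (Q c).coeff ((e : ℕ) + 2) = c e := by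
    intro c e
    rw [hQ, finsetSum_coeff]
    simp [coeff_monomial, Fin.val_inj]
  have hv' := fun x => congrFun (LinearMap.mem_ker.1 hv) x
  refine ⟨v.1, v.2.1, Q v.2.2, ?_, ?_, ?_, ?_, ?_⟩
  · rintro ⟨h1, h2, h3⟩
    refine hv0 (Prod.ext h1 (Prod.ext h2 (_root_.funext fun e => ?_)))
    exact (hcoeff v.2.2 e).symm.trans (by rw [h3]; simp)
  · rw [hQ]
    refine natDegree_sum_le_of_forall_le _ _ fun e _ => (natDegree_monomial_le _).trans ?_
    omega
  · rw [hQ, finsetSum_coeff]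
    simp [coeff_monomial]
  · rw [hQ, finsetSum_coeff]
    simp [coeff_monomial]
  · intro i t ht
    have := hv' ⟨i, t, ht⟩
    rw [← hP]
    exact ⟨congrArg Prod.fst this, congrArg Prod.snd this⟩

open Polynomial in
theorem Polynomial.derivative_derivative_affine_add (l m : ℝ) (q : ℝ[X]) :
    (C l + C m * X + q).derivative.derivative = q.derivative.derivative := by
  simp

open Polynomial in
/-- If `hi i < lo j` for `i < j`, there are polynomials differing pairwise by affine ones, the
`i`-th of which vanishes on `T i ⊆ [lo i, hi i]` and is positive on the rest of `[lo i, hi i]`. -/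
theorem Polynomial.exists_vanish_pos {ι : Type*} [Fintype ι] [LinearOrder ι]
    (T : ι → Finset ℝ) (lo hi : ι → ℝ) (hlohi : ∀ i j, i < j → hi i < lo j)
    (hT : ∀ i, ∀ t ∈ T i, t ∈ Set.Icc (lo i) (hi i)) (hne : ∀ i, (T i).Nonempty) (N : ℕ)
    (hN : ∑ i, 2 * (T i).card = 2 * Fintype.card ι + N) :
    ∃ (l m : ι → ℝ) (q : ℝ[X]), q.natDegree ≤ N + 2 ∧ q.coeff 0 = 0 ∧ q.coeff 1 = 0 ∧
      ∀ i, (∀ t ∈ T i, l i + m i * t + q.eval t = 0) ∧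
        ∀ t ∈ Set.Icc (lo i) (hi i), t ∉ T i → 0 < l i + m i * t + q.eval t := by
  obtain ⟨l, m, q, hnz, hdeg, hq0, hq1, hz⟩ := exists_double_zeros T N hN
  set w := q.derivative.derivative with hw
  have hJ : ∀ i j, i < j → ∀ x ∈ Set.Icc (lo i) (hi i), ∀ y ∈ Set.Icc (lo j) (hi j), x < y :=
    fun i j hij x hx y hy => hx.2.trans_lt ((hlohi i j hij).trans_le hy.1)
  have hP'' : ∀ i, (C (l i) + C (m i) * X + q).derivative.derivative = w := fun i =>
    derivative_derivative_affine_add (l i) (m i) q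
  have hwcoeff : ∀ e, w.coeff e = q.coeff (e + 2) * ((e + 1 + 1) * (e + 1)) := fun e => by
    rw [hw, coeff_derivative, coeff_derivative]; push_cast; ring
  have hw0 : w ≠ 0 := by
    intro h0
    have hq : q = 0 := by
      ext e
      rcases e with _ | _ | e
      · simpa using hq0
      · simpa using hq1
      · have := hwcoeff e
        rw [h0, coeff_zero, eq_comm, mul_eq_zero] at this
        rcases this with h | h
        · simpa using h
        · exact absurd h (by positivity)
    -- An affine function with a double zero vanishes; this is where `T i` must be nonempty.
    have hlm : ∀ i, l i = 0 ∧ m i = 0 := fun i => by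
      obtain ⟨t, ht⟩ := hne i
      obtain ⟨h1, h2⟩ := hz i t ht
      simp only [hq, add_zero, derivative_add, derivative_C, derivative_C_mul, derivative_X,
        mul_one, zero_add, eval_C] at h2
      exact ⟨by simpa [hq, h2] using h1, h2⟩
    exact hnz ⟨_root_.funext fun i => (hlm i).1, _root_.funext fun i => (hlm i).2, hq⟩
  have hwdeg : w.natDegree ≤ N := by
    refine natDegree_le_iff_coeff_eq_zero.2 fun e he => ?_
    rw [hwcoeff, coeff_eq_zero_of_natDegree_lt (by omega), zero_mul]
  have hRolle : ∀ i, ∀ A : Finset ℝ, T i ⊆ A → (∀ a ∈ A, a ∈ Set.Icc (lo i) (hi i)) →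
      (∀ a ∈ A, (C (l i) + C (m i) * X + q).eval a = 0) →
      ∃ B : Finset ℝ, B.card + 2 = A.card + (T i).card ∧ Disjoint (T i) B ∧
        (∀ b ∈ B, w.eval b = 0 ∧ b ∈ Set.Icc (lo i) (hi i)) ∧ ∀ b ∈ B, ∃ a ∈ A, b < a := by
    intro i A hTA hAJ hA
    obtain ⟨B, h1, h2, h3⟩ := exists_finset_derivative_derivative_zeros
      (C (l i) + C (m i) * X + q) (T i) A (hne i) hTA hA fun a ha => (hz i a ha).2
    refine ⟨B, h1, h2, fun b hb => ?_, fun b hb => (h3 b hb).2.2⟩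
    obtain ⟨h0, ⟨a, ha, hab⟩, a', ha', hab'⟩ := h3 b hb
    rw [hP''] at h0
    exact ⟨h0, ((hAJ a ha).1.trans hab.le), hab'.le.trans (hAJ a' ha').2⟩
  choose B hBcard hBT hB hBlt using fun i =>
    hRolle i (T i) subset_rfl (hT i) fun a ha => (hz i a ha).1
  have hBsum : ∑ i, (B i).card = N := by
    have : ∑ i, ((B i).card + 2) = ∑ i, 2 * (T i).card :=
      Finset.sum_congr rfl fun i _ => by rw [hBcard]; ring
    rw [hN, Finset.sum_add_distrib] at this
    simp only [Finset.sum_const, Finset.card_univ, smul_eq_mul] at this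
    omega
  -- no set of zeros of `w` in one of the intervals exceeds the one found by Rolle's theorem
  have hmax : ∀ i (B' : Finset ℝ), (∀ b ∈ B', w.eval b = 0 ∧ b ∈ Set.Icc (lo i) (hi i)) →
      B'.card ≤ (B i).card := by
    intro i B' hB'
    -- Exchanging `B i` for a larger `B'` would give `w` more than `N` roots.
    obtain ⟨hc, hs⟩ := w.card_biUnion_zeros_and_subset_roots hw0 _ hJ (Function.update B i B') (by
      intro j
      rcases eq_or_ne j i with rfl | hji
      · simpa using hB'
      · simpa [hji] using hB j)
    have h1 := (Finset.card_le_card hs).trans ((Multiset.toFinset_card_le _).trans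
      ((card_roots' w).trans hwdeg))
    rw [hc, ← hBsum, ← Finset.add_sum_erase _ _ (Finset.mem_univ i),
      ← Finset.add_sum_erase _ (fun i => (B i).card) (Finset.mem_univ i)] at h1
    rw [Finset.sum_congr rfl (g := fun j => (B j).card) fun j hj => by
      rw [Function.update_of_ne (Finset.ne_of_mem_erase hj)]] at h1
    simpa using h1
  have hextra : ∀ i, ∀ t ∈ Set.Icc (lo i) (hi i), t ∉ T i →
      (C (l i) + C (m i) * X + q).eval t ≠ 0 := by
    intro i t ht htT h0
    obtain ⟨B', hc, -, hB', -⟩ := hRolle i (insert t (T i)) (Finset.subset_insert _ _)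
      (Finset.forall_mem_insert _ _ _ |>.2 ⟨ht, hT i⟩)
      (Finset.forall_mem_insert _ _ _ |>.2 ⟨h0, fun a ha => (hz i a ha).1⟩)
    have := hmax i B' hB'
    rw [Finset.card_insert_of_notMem htT] at hc
    have := hBcard i
    omega
  -- The Rolle zeros avoid `T i`, so a zero of `w` there would be one too many.
  have htriple : ∀ i, ∀ t ∈ T i, w.eval t ≠ 0 := by
    intro i t ht h0
    have htB : t ∉ B i := Finset.disjoint_left.1 (hBT i) ht
    have := hmax i (insert t (B i)) (Finset.forall_mem_insert _ _ _ |>.2 ⟨⟨h0, hT i t ht⟩, hB i⟩)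
    rw [Finset.card_insert_of_notMem htB] at this
    omega
  have hsign : ∀ i, 0 < w.eval ((T i).max' (hne i)) * w.leadingCoeff := by
    intro i
    refine w.eval_mul_leadingCoeff_pos hw0 _ hJ B hB (hBsum ▸ hwdeg) (fun j => ?_) i _
      (hT i _ ((T i).max'_mem _)) fun b hb => ?_
    · have := hBcard j
      exact ⟨(T j).card - 1, by omega⟩
    · obtain ⟨a, ha, hba⟩ := hBlt i b hb
      exact hba.trans_le ((T i).le_max' a ha)
  have hpos : ∀ i, ∀ t ∈ Set.Icc (lo i) (hi i), t ∉ T i →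
      0 < (C (l i) + C (m i) * X + q).eval t * w.leadingCoeff := by
    intro i t ht htT
    obtain ⟨R, hR⟩ := exists_eq_prod_sq_mul (C (l i) + C (m i) * X + q) (T i)
      (fun a ha => (hz i a ha).1) fun a ha => (hz i a ha).2
    have hwR : ∀ a ∈ T i, w.eval a = 2 * ((∏ b ∈ (T i).erase a, (a - b) ^ 2) * R.eval a) := by
      intro a ha
      rw [← hP'' i, hR, ← Finset.mul_prod_erase _ _ ha, mul_assoc,
        eval_derivative_derivative_sq_mul]
      simp [eval_prod]
    -- With the squares removed, `R` keeps one sign on the interval, and `w` at the largest point of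
    -- `T i` reveals which.
    have hR0 : ∀ x ∈ Set.Icc (lo i) (hi i), R.eval x ≠ 0 := by
      intro x hx h0
      by_cases hxT : x ∈ T i
      · exact htriple i x hxT (by rw [hwR x hxT, h0]; simp)
      · exact hextra i x hx hxT (by rw [hR, eval_mul, h0, mul_zero])
    have hamem := (T i).max'_mem (hne i)
    have hRa : 0 < R.eval ((T i).max' (hne i)) * w.leadingCoeff := by
      have h := hsign i
      rw [hwR _ hamem, mul_assoc, mul_assoc] at h
      exact pos_of_mul_pos_right (pos_of_mul_pos_right h zero_le_two)
        (Finset.prod_nonneg fun _ _ => sq_nonneg _)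
    have hRt : 0 < R.eval t * w.leadingCoeff := by
      by_contra hcon
      have hcont : ContinuousOn (fun x => R.eval x * w.leadingCoeff) (Set.Icc (lo i) (hi i)) := by
        fun_prop
      obtain ⟨x, hx, hx0⟩ := isPreconnected_Icc.intermediate_value ht (hT i _ hamem) hcont
        ⟨not_lt.1 hcon, hRa.le⟩
      rcases mul_eq_zero.1 hx0 with h | h
      · exact hR0 x hx h
      · exact hw0 (leadingCoeff_eq_zero.1 h)
    rw [hR, eval_mul, mul_assoc, eval_prod]
    refine mul_pos (Finset.prod_pos fun b hb => ?_) hRt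
    have : t - b ≠ 0 := sub_ne_zero.2 fun h => htT (h ▸ hb)
    simp only [eval_pow, eval_sub, eval_X, eval_C]
    positivity
  -- Scaling by the leading coefficient makes the common sign positive.
  refine ⟨fun i => w.leadingCoeff * l i, fun i => w.leadingCoeff * m i, C w.leadingCoeff * q,
    (natDegree_C_mul_le _ _).trans hdeg, by simp [hq0], by simp [hq1],
    fun i => ⟨fun t ht => ?_, fun t ht htT => ?_⟩⟩
  · have := (hz i t ht).1
    simp only [eval_add, eval_mul, eval_C, eval_X] at this ⊢
    linear_combination w.leadingCoeff * this
  · have := hpos i t ht htT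
    simp only [eval_add, eval_mul, eval_C, eval_X] at this ⊢
    linarith

/-! ### Exposed faces of convex hulls -/

section ConvexHull

variable {E ι : Type*} [AddCommGroup E] [Module ℝ E]

theorem convexHull_range_inter_level (p : ι → E) (f : E →ₗ[ℝ] ℝ) (c : ℝ)
    (h : ∀ i, f (p i) ≤ c) :
    {x ∈ convexHull ℝ (Set.range p) | f x = c} = convexHull ℝ (p '' {i | f (p i) = c}) := by
  apply Set.Subset.antisymm
  -- `D` is convex because a proper convex combination reaches the top level only if both its ends
  -- do.
  · let D : Set E := {x | f x ≤ c ∧ (f x = c → x ∈ convexHull ℝ (p '' {i | f (p i) = c}))}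
    have hD : Convex ℝ D := by
      refine convex_iff_forall_pos.2 fun x hx y hy a b ha hb hab => ?_
      have hax := mul_le_mul_of_nonneg_left hx.1 ha.le
      have hby := mul_le_mul_of_nonneg_left hy.1 hb.le
      have hc : a * c + b * c = c := by rw [← add_mul, hab, one_mul]
      refine ⟨by simp only [map_add, map_smul, smul_eq_mul]; linarith, fun h0 => ?_⟩
      simp only [map_add, map_smul, smul_eq_mul] at h0
      have hxc : f x = c := mul_left_cancel₀ ha.ne' (by linarith)
      have hyc : f y = c := mul_left_cancel₀ hb.ne' (by linarith)
      exact convex_convexHull ℝ _ (hx.2 hxc) (hy.2 hyc) ha.le hb.le hab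
    have hsub : convexHull ℝ (Set.range p) ⊆ D := by
      refine convexHull_min ?_ hD
      rintro _ ⟨i, rfl⟩
      exact ⟨h i, fun hi => subset_convexHull ℝ _ ⟨i, hi, rfl⟩⟩
    exact fun x hx => (hsub hx.1).2 hx.2
  · refine fun x hx => ⟨convexHull_mono (Set.image_subset_range _ _) hx, ?_⟩
    have : convexHull ℝ (p '' {i | f (p i) = c}) ⊆ {x | f x = c} := by
      refine convexHull_min ?_ (convex_hyperplane f.isLinear c)
      rintro _ ⟨i, hi, rfl⟩
      exact hi
    exact this hx

theorem le_of_mem_convexHull_range (p : ι → E) (f : E →ₗ[ℝ] ℝ) (c : ℝ)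
    (h : ∀ i, f (p i) ≤ c) {x : E} (hx : x ∈ convexHull ℝ (Set.range p)) : f x ≤ c := by
  have : convexHull ℝ (Set.range p) ⊆ {x | f x ≤ c} := by
    refine convexHull_min ?_ (convex_halfSpace_le f.isLinear c)
    rintro _ ⟨i, rfl⟩
    exact h i
  exact this hx

variable [TopologicalSpace E]

theorem isExposed_convexHull_image (p : ι → E) (f : E →L[ℝ] ℝ) (c : ℝ) (T : Set ι)
    (hT : ∀ i ∈ T, f (p i) = c) (hT' : ∀ i ∉ T, f (p i) < c) :
    IsExposed ℝ (convexHull ℝ (Set.range p)) (convexHull ℝ (p '' T)) := by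
  have hle : ∀ i, f (p i) ≤ c := fun i => by
    by_cases hi : i ∈ T
    exacts [(hT i hi).le, (hT' i hi).le]
  have hTeq : {i | f (p i) = c} = T := by
    ext i
    refine ⟨fun hi => ?_, hT i⟩
    by_contra hiT
    exact (hT' i hiT).ne hi
  rintro ⟨x, hx⟩
  refine ⟨f, ?_⟩
  have hlevel := convexHull_range_inter_level p f.toLinearMap c hle
  simp only [ContinuousLinearMap.coe_coe, hTeq] at hlevel
  rw [← hlevel] at hx ⊢
  ext y
  refine ⟨fun hy => ⟨hy.1, fun z hz => ?_⟩, fun hy => ⟨hy.1, ?_⟩⟩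
  · rw [hy.2]
    exact le_of_mem_convexHull_range p f.toLinearMap c hle hz
  · exact le_antisymm (le_of_mem_convexHull_range p f.toLinearMap c hle hy.1)
      (hx.2 ▸ hy.2 x hx.1)

theorem IsExposed.eq_convexHull_image {p : ι → E} {F : Set E}
    (hF : IsExposed ℝ (convexHull ℝ (Set.range p)) F) (hne : F.Nonempty) :
    F = convexHull ℝ (p '' {i | p i ∈ F}) := by
  obtain ⟨f, hf⟩ := hF hne
  obtain ⟨x, hx⟩ := hne
  rw [hf] at hx
  have hmem : ∀ i, p i ∈ convexHull ℝ (Set.range p) := fun i =>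
    subset_convexHull ℝ _ ⟨i, rfl⟩
  have hle : ∀ i, f (p i) ≤ f x := fun i => hx.2 _ (hmem i)
  have hFx : F = {y ∈ convexHull ℝ (Set.range p) | f y = f x} := by
    rw [hf]
    ext y
    refine ⟨fun hy => ⟨hy.1, le_antisymm (hx.2 y hy.1) (hy.2 x hx.1)⟩, fun hy => ⟨hy.1, ?_⟩⟩
    intro z hz
    rw [hy.2]
    exact hx.2 z hz
  have hlevel := convexHull_range_inter_level p f.toLinearMap (f x) hle
  simp only [ContinuousLinearMap.coe_coe] at hlevel
  have hset : {i | p i ∈ F} = {i | f (p i) = f x} := by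
    ext i
    rw [Set.mem_ofPred_eq, hFx]
    exact ⟨fun h => h.2, fun h => ⟨hmem i, h⟩⟩
  rw [hset, ← hlevel, ← hFx]

/-- Applying `f - c` to an affine relation kills every term except the one at `x`. -/
theorem affineIndependent_of_forall_exists_functional (p : ι → E) (T : Finset ι)
    (h : ∀ x ∈ T, ∃ (f : E →L[ℝ] ℝ) (c : ℝ), c < f (p x) ∧ ∀ y ∈ T, y ≠ x → f (p y) = c) :
    AffineIndependent ℝ fun x : T => p x := by
  rw [affineIndependent_iff]
  intro s w hw hwp x hx
  obtain ⟨f, c, hc, hf⟩ := h x x.2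
  have h1 : ∑ y ∈ s, w y * (f (p y) - c) = 0 := by
    have h2 := congrArg f hwp
    simp only [map_sum, map_smul, smul_eq_mul, map_zero] at h2
    simp only [mul_sub, Finset.sum_sub_distrib, h2, ← Finset.sum_mul, hw, zero_mul, sub_zero]
  rw [Finset.sum_eq_single_of_mem x hx fun y _ hyx => by
    rw [hf y y.2 (fun h => hyx (Subtype.ext h)), sub_self, mul_zero]] at h1
  exact (mul_eq_zero.1 h1).resolve_right (sub_pos.2 hc).ne'

theorem isExposed_singleton_convexHull (p : ι → E) (T : Finset ι)
    (h : ∀ x ∈ T, ∃ (f : E →L[ℝ] ℝ) (c : ℝ), c < f (p x) ∧ ∀ y ∈ T, y ≠ x → f (p y) = c)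
    (z : E) : IsExposed ℝ (convexHull ℝ (p '' (T : Set ι))) {z} ↔ z ∈ p '' (T : Set ι) := by
  constructor
  · intro hz
    exact extremePoints_convexHull_subset (exposedPoints_subset_extremePoints
      (mem_exposedPoints_iff_exposed_singleton.2 hz))
  · rintro ⟨x, hx, rfl⟩
    obtain ⟨f, c, hc, hf⟩ := h x hx
    have := isExposed_convexHull_image (fun y : T => p y) f (f (p x)) {⟨x, hx⟩} (by simp)
      (fun y hy => by
        rw [hf y y.2 fun h => hy (Subtype.ext h)]
        exact hc)
    simpa [Set.image_eq_range] using this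

end ConvexHull

/-! ### Supporting functionals at Cayley points -/

namespace CayleySum

/-- The points are affinely independent; the shift `c` is needed because `g` is linear and `e_0 =
0`. -/
theorem exists_functional_affBasis (r : ℕ) (a : Fin r → ℝ) :
    ∃ (g : (Fin (r - 1) → ℝ) →L[ℝ] ℝ) (c : ℝ), ∀ i, g (affBasis r i) = a i + c := by
  rcases r with _ | r
  · exact ⟨0, 0, fun i => i.elim0⟩
  refine ⟨∑ m : Fin r, (a m.succ - a 0) • ContinuousLinearMap.proj (R := ℝ) (φ := fun _ => ℝ) m,
    -a 0, fun i => ?_⟩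
  simp only [sum_apply, smul_apply,
    ContinuousLinearMap.proj_apply, affBasis, smul_eq_mul]
  refine Fin.cases ?_ (fun m => ?_) i
  · simp
  · simp [Fin.val_inj, sub_eq_add_neg]

open Polynomial in
-- The first `r` coordinates see only `t`, in the slot of its block; the remaining ones carry the
-- powers shared by all blocks.
theorem exists_functional_momentCurve {r d : ℕ} (hrd : r ≤ d) (m : Fin r → ℝ) (q : ℝ[X])
    (hq : q.natDegree ≤ d - r + 1) (hq0 : q.coeff 0 = 0) (hq1 : q.coeff 1 = 0) :
    ∃ g : (Fin d → ℝ) →L[ℝ] ℝ, ∀ i t, g (momentCurve d i t) = m i * t + q.eval t := by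
  obtain ⟨e, rfl⟩ := Nat.exists_eq_add_of_le hrd
  let coef : Fin (r + e) → ℝ := Fin.append m fun j : Fin e => q.coeff (j + 2)
  refine ⟨∑ j, coef j • ContinuousLinearMap.proj (R := ℝ) (φ := fun _ => ℝ) j, fun i t => ?_⟩
  simp only [sum_apply, smul_apply,
    ContinuousLinearMap.proj_apply, smul_eq_mul]
  rw [Fin.sum_univ_add]
  congr 1
  · simp [coef, momentCurve, Fin.val_inj]
  · rw [eval_eq_sum_range' (n := e + 2) (by omega), Finset.sum_range_succ', Finset.sum_range_succ',
      hq0, hq1, Finset.sum_range]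
    simp [coef, momentCurve]

/-- The points of the Cayley embedding of points on the moment curves with parameters `t i j`. -/
noncomputable def cayleyPoint {r : ℕ} (d : ℕ) {n : Fin r → ℕ} (t : (i : Fin r) → Fin (n i) → ℝ)
    (x : (i : Fin r) × Fin (n i)) : Ambient r d :=
  cayleyIncl x.1 (momentCurve d x.1 (t x.1 x.2))

theorem affBasis_injective (r : ℕ) : Function.Injective (affBasis r) := by
  intro i j h
  obtain ⟨g, c, hg⟩ := exists_functional_affBasis r fun i => ((i : ℕ) : ℝ)
  have := hg i
  rw [h, hg j] at this
  exact Fin.ext (by exact_mod_cast (add_right_cancel this).symm)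

theorem cayleyPoint_injective {r d : ℕ} (hrd : r ≤ d) {n : Fin r → ℕ}
    {t : (i : Fin r) → Fin (n i) → ℝ} (ht : ∀ i, StrictMono (t i)) :
    Function.Injective (cayleyPoint d t) := by
  rintro ⟨i, j⟩ ⟨i', j'⟩ h
  obtain rfl : i = i' := affBasis_injective r (congrArg Prod.fst h)
  have := congrFun (congrArg Prod.snd h) (Fin.castLE hrd i)
  simp only [cayleyPoint, cayleyIncl, momentCurve, Fin.val_castLE, i.2, if_true] at this
  rw [(ht i).injective this]

/-- The index set `T` meets all the blocks. -/
def MeetsAll {r : ℕ} {n : Fin r → ℕ} (T : Finset ((i : Fin r) × Fin (n i))) : Prop :=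
  ∀ i, ∃ j, (⟨i, j⟩ : (i : Fin r) × Fin (n i)) ∈ T

theorem MeetsAll.le_card {r : ℕ} {n : Fin r → ℕ} {T : Finset ((i : Fin r) × Fin (n i))}
    (hT : MeetsAll T) : r ≤ T.card := by
  choose j hj using hT
  have := Finset.card_le_card (s := Finset.univ.image fun i => (⟨i, j i⟩ : (i : Fin r) × Fin (n i)))
    (t := T) (Finset.image_subset_iff.2 fun i _ => hj i)
  rwa [Finset.card_image_of_injective _ fun i i' h => congrArg Sigma.fst h, Finset.card_univ,
    Fintype.card_fin] at this

theorem exists_supporting_functional {r d : ℕ} (hrd : r ≤ d) {n : Fin r → ℕ}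
    {t : (i : Fin r) → Fin (n i) → ℝ} (ht : ∀ i, StrictMono (t i))
    (hsep : ∀ i i', i < i' → ∀ j j', t i j < t i' j') (T : Finset ((i : Fin r) × Fin (n i)))
    (hT : MeetsAll T) (hcard : 2 * T.card + 1 ≤ d + r) :
    ∃ (f : Ambient r d →L[ℝ] ℝ) (c : ℝ), (∀ x ∈ T, f (cayleyPoint d t x) = c) ∧
      ∀ x ∉ T, f (cayleyPoint d t x) < c := by
  have hn : ∀ i, 0 < n i := fun i => (hT i).choose.pos
  let B (i : Fin r) : Finset (Fin (n i)) := Finset.univ.filter fun j => ⟨i, j⟩ ∈ T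
  have hB : Finset.univ.sigma B = T := by
    ext ⟨i, j⟩
    simp [B]
  have hBcard : ∑ i, (B i).card = T.card := by rw [← hB, Finset.card_sigma]
  have hle := hT.le_card
  have hmem : ∀ i j, t i j ∈ Set.Icc (t i ⟨0, hn i⟩) (t i ⟨n i - 1, by have := hn i; omega⟩) :=
    fun i j => ⟨(ht i).monotone (Fin.mk_le_of_le_val (Nat.zero_le _)),
      (ht i).monotone (Fin.le_def.2 (by simp only; omega))⟩
  obtain ⟨l, m, q, hdeg, hq0, hq1, hP⟩ := Polynomial.exists_vanish_pos
    (fun i => (B i).image (t i)) (fun i => t i ⟨0, hn i⟩)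
    (fun i => t i ⟨n i - 1, by have := hn i; omega⟩) (fun i j hij => hsep i j hij _ _)
    (fun i s hs => by
      obtain ⟨j, -, rfl⟩ := Finset.mem_image.1 hs
      exact hmem i j)
    (fun i => by
      obtain ⟨j, hj⟩ := hT i
      exact ⟨t i j, Finset.mem_image_of_mem _ (by simpa [B] using hj)⟩)
    -- The subtraction is not truncated, as `r ≤ |T|`. The degree bound becomes `2|T| - 2r + 2 ≤ d -
    -- r + 1`, which is `hcard`.
    (2 * T.card - 2 * r) (by
      simp only [Finset.card_image_of_injective _ (ht _).injective]
      rw [← Finset.mul_sum, hBcard, Fintype.card_fin]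
      omega)
  obtain ⟨g, c, hg⟩ := exists_functional_affBasis r l
  obtain ⟨g', hg'⟩ := exists_functional_momentCurve hrd m q (by omega) hq0 hq1
  let f : Ambient r d →L[ℝ] ℝ :=
    -(g.comp (ContinuousLinearMap.fst ℝ _ _) + g'.comp (ContinuousLinearMap.snd ℝ _ _))
  have hval : ∀ x, f (cayleyPoint d t x) = -c - (l x.1 + m x.1 * t x.1 x.2 + q.eval (t x.1 x.2)) := fun x => by
    simp only [f, cayleyPoint, cayleyIncl, neg_apply,
      add_apply, ContinuousLinearMap.comp_apply,
      ContinuousLinearMap.coe_fst', ContinuousLinearMap.coe_snd', hg, hg']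
    ring
  refine ⟨f, -c, fun x hx => ?_, fun x hx => ?_⟩
  · rw [hval, (hP x.1).1 _ (Finset.mem_image_of_mem _ (by simpa [B] using hx)), sub_zero]
  · have := (hP x.1).2 (t x.1 x.2) (hmem _ _) fun h => by
      obtain ⟨j, hj, hjx⟩ := Finset.mem_image.1 h
      rw [(ht x.1).injective hjx] at hj
      exact hx (by simpa [B] using hj)
    rw [hval]
    linarith

theorem exists_functional_block {r : ℕ} (i : Fin r) : ∃ (g : (Fin (r - 1) → ℝ) →L[ℝ] ℝ) (c : ℝ), g (affBasis r i) = c + 1 ∧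
      ∀ i', i' ≠ i → g (affBasis r i') = c := by
  obtain ⟨g, c, hg⟩ := exists_functional_affBasis r (Pi.single i 1)
  exact ⟨g, c, by rw [hg, Pi.single_eq_same, add_comm],
    fun i' h => by rw [hg, Pi.single_eq_of_ne h, zero_add]⟩

/-- If `T` without `x` still spans, its supporting functional separates `x`; otherwise `x` is alone
in its block, and the block does. Since only the smaller set needs support, `T` may have one point
more than in `exists_supporting_functional`. -/
theorem exists_functional_vertex {r d : ℕ} (hrd : r ≤ d) {n : Fin r → ℕ}
    {t : (i : Fin r) → Fin (n i) → ℝ} (ht : ∀ i, StrictMono (t i))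
    (hsep : ∀ i i', i < i' → ∀ j j', t i j < t i' j') (T : Finset ((i : Fin r) × Fin (n i)))
    (hT : MeetsAll T) (hcard : 2 * T.card ≤ d + r + 1) (x) (hx : x ∈ T) :
    ∃ (f : Ambient r d →L[ℝ] ℝ) (c : ℝ), c < f (cayleyPoint d t x) ∧
      ∀ y ∈ T, y ≠ x → f (cayleyPoint d t y) = c := by
  by_cases hT' : MeetsAll (T.erase x)
  · have := Finset.card_erase_add_one hx
    obtain ⟨f, c, h1, h2⟩ := exists_supporting_functional hrd ht hsep (T.erase x) hT' (by omega)
    refine ⟨-f, -c, neg_lt_neg (h2 x (Finset.notMem_erase x T)), fun y hy hyx => ?_⟩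
    rw [neg_apply, h1 y (Finset.mem_erase.2 ⟨hyx, hy⟩)]
  · unfold MeetsAll at hT'
    push Not at hT'
    obtain ⟨i, hi⟩ := hT'
    have hblock : ∀ y ∈ T, y ≠ x → y.1 ≠ i := by
      rintro ⟨i', j⟩ hy hyx rfl
      exact hi j (Finset.mem_erase.2 ⟨hyx, hy⟩)
    have hxi : x.1 = i := by
      obtain ⟨j, hj⟩ := hT i
      by_contra hne
      exact hblock _ hj (fun h => hne (by rw [← h])) rfl
    obtain ⟨g, c, h1, h2⟩ := exists_functional_block i
    refine ⟨g.comp (ContinuousLinearMap.fst ℝ _ _), c, ?_, fun y hy hyx => h2 _ (hblock y hy hyx)⟩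
    change c < g (affBasis r x.1)
    rw [hxi, h1]
    exact lt_add_one c

end CayleySum

/-! ### Faces that meet the averaging flat -/

namespace CayleySum

theorem faceDim_convexHull_image {r d : ℕ} {ι : Type*} (p : ι → Ambient r d) (T : Finset ι) :
    faceDim (convexHull ℝ (p '' (T : Set ι))) =
      Module.finrank ℝ (vectorSpan ℝ (Set.range fun x : T => p x)) := by
  rw [faceDim, affineSpan_convexHull, direction_affineSpan, Set.image_eq_range]
  rfl

section Separated

variable {r d : ℕ} {n : Fin r → ℕ} {t : (i : Fin r) → Fin (n i) → ℝ}

theorem exists_subset_meetsAll {V : Finset ((i : Fin r) × Fin (n i))} (hV : MeetsAll V) {m : ℕ}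
    (hrm : r ≤ m) (hm : m ≤ V.card) : ∃ T ⊆ V, MeetsAll T ∧ T.card = m := by
  choose j hj using hV
  let R := Finset.univ.image fun i => (⟨i, j i⟩ : (i : Fin r) × Fin (n i))
  have hRcard : R.card ≤ m := by
    refine Finset.card_image_le.trans ?_
    simpa using hrm
  obtain ⟨T, hRT, hTV, hT⟩ := Finset.exists_subsuperset_card_eq
    (Finset.image_subset_iff.2 fun i _ => hj i : R ⊆ V) hRcard hm
  exact ⟨T, hTV, fun i => ⟨j i, hRT (Finset.mem_image_of_mem _ (Finset.mem_univ i))⟩, hT⟩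

theorem finrank_vectorSpan_of_meetsAll (hrd : r ≤ d) (ht : ∀ i, StrictMono (t i))
    (hsep : ∀ i i', i < i' → ∀ j j', t i j < t i' j') {T : Finset ((i : Fin r) × Fin (n i))}
    (hT : MeetsAll T) (hcard : 2 * T.card ≤ d + r + 1) (hpos : 0 < T.card) :
    Module.finrank ℝ (vectorSpan ℝ (Set.range fun x : T => cayleyPoint d t x)) = T.card - 1 :=
  (affineIndependent_of_forall_exists_functional (cayleyPoint d t) T
    (exists_functional_vertex hrd ht hsep T hT hcard)).finrank_vectorSpan
      (by rw [Fintype.card_coe]; omega)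

theorem vertexSet_convexHull_of_meetsAll (hrd : r ≤ d) (ht : ∀ i, StrictMono (t i))
    (hsep : ∀ i i', i < i' → ∀ j j', t i j < t i' j') {T : Finset ((i : Fin r) × Fin (n i))}
    (hT : MeetsAll T) (hcard : 2 * T.card ≤ d + r + 1) :
    vertexSet (convexHull ℝ (cayleyPoint d t '' (T : Set _))) =
      cayleyPoint d t '' (T : Set ((i : Fin r) × Fin (n i))) := by
  ext z
  rw [← isExposed_singleton_convexHull (cayleyPoint d t) T
    (exists_functional_vertex hrd ht hsep T hT hcard)]
  exact and_iff_left (Set.singleton_nonempty z)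

theorem isFace_convexHull_of_meetsAll (hr : 0 < r) (hrd : r ≤ d) (ht : ∀ i, StrictMono (t i))
    (hsep : ∀ i i', i < i' → ∀ j j', t i j < t i' j') {T : Finset ((i : Fin r) × Fin (n i))}
    (hT : MeetsAll T) (hcard : 2 * T.card + 1 ≤ d + r) :
    IsFace (convexHull ℝ (Set.range (cayleyPoint d t)))
      (convexHull ℝ (cayleyPoint d t '' (T : Set ((i : Fin r) × Fin (n i))))) := by
  obtain ⟨f, c, h1, h2⟩ := exists_supporting_functional hrd ht hsep T hT hcard
  refine ⟨isExposed_convexHull_image _ f c _ h1 h2, ?_⟩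
  obtain ⟨j, hj⟩ := hT ⟨0, hr⟩
  exact ⟨_, subset_convexHull ℝ _ ⟨_, hj, rfl⟩⟩

theorem convexHull_inter_avgFlat_nonempty_iff (hr : 0 < r)
    (T : Finset ((i : Fin r) × Fin (n i))) :
    (convexHull ℝ (cayleyPoint d t '' (T : Set ((i : Fin r) × Fin (n i)))) ∩
      avgFlat r d).Nonempty ↔ MeetsAll T := by
  have hr' : (r : ℝ) ≠ 0 := by positivity
  constructor
  · rintro ⟨x, hx, hxavg⟩ i
    by_contra! hi
    obtain ⟨g, c, h1, h2⟩ := exists_functional_block i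
    -- If block `i` is missed, its functional is constantly `c` on the hull, but it equals `c + 1/r`
    -- on the flat.
    have hsub : convexHull ℝ (cayleyPoint d t '' (T : Set ((i : Fin r) × Fin (n i)))) ⊆
        {x | (g.comp (ContinuousLinearMap.fst ℝ _ _)) x = c} := by
      refine convexHull_min ?_ (convex_hyperplane
        (g.comp (ContinuousLinearMap.fst ℝ _ _)).toLinearMap.isLinear c)
      rintro _ ⟨⟨i', j⟩, hij, rfl⟩
      refine h2 i' ?_
      rintro rfl
      exact hi j hij
    have hgx : g x.1 = c := hsub hx
    rw [show x.1 = _ from hxavg, map_sum, ← Finset.add_sum_erase _ _ (Finset.mem_univ i),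
      Finset.sum_congr rfl fun i' hi' => by
        rw [map_smul, h2 i' (Finset.ne_of_mem_erase hi')], map_smul, h1] at hgx
    have hsum : (1 / (r : ℝ)) • (c + 1) + ∑ i' ∈ Finset.univ.erase i, (1 / (r : ℝ)) • c =
        1 / r + ∑ i' : Fin r, (1 / (r : ℝ)) • c := by
      rw [← Finset.add_sum_erase _ _ (Finset.mem_univ i)]
      simp only [smul_eq_mul]
      ring
    rw [hsum, Finset.sum_const, Finset.card_univ, Fintype.card_fin, nsmul_eq_mul, smul_eq_mul,
      ← mul_assoc, mul_one_div_cancel hr', one_mul, add_eq_right] at hgx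
    exact one_div_ne_zero hr' hgx
  · intro hT
    choose j hj using hT
    refine ⟨∑ i, (1 / (r : ℝ)) • cayleyPoint d t ⟨i, j i⟩, ?_, ?_⟩
    · refine (convex_convexHull ℝ _).sum_mem (fun i _ => by positivity) ?_ fun i _ =>
        subset_convexHull ℝ _ ⟨_, hj i, rfl⟩
      simp [hr']
    · simp [avgFlat, cayleyPoint, cayleyIncl, Prod.fst_sum]

/-- The `m`-dimensional faces meeting the averaging flat are the convex hulls of the spanning sets
of `m + 1` vertices. -/
theorem setOf_flatFaces_eq_image (hr : 0 < r) (hrd : r ≤ d) (ht : ∀ i, StrictMono (t i))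
    (hsep : ∀ i i', i < i' → ∀ j j', t i j < t i' j') {k : ℕ} (hrk : r ≤ k)
    (hk : 2 * k + 1 ≤ d + r) :
    {F ∈ flatFaces (convexHull ℝ (Set.range (cayleyPoint d t))) | faceDim F = k - 1} =
      (fun T : Finset ((i : Fin r) × Fin (n i)) =>
        convexHull ℝ (cayleyPoint d t '' (T : Set ((i : Fin r) × Fin (n i))))) ''
        {T | MeetsAll T ∧ T.card = k} := by
  classical
  ext F
  constructor
  · rintro ⟨⟨⟨hexp, hne⟩, havg⟩, hdim⟩
    have hF := hexp.eq_convexHull_image hne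
    set V : Finset ((i : Fin r) × Fin (n i)) :=
      Finset.univ.filter fun x => cayleyPoint d t x ∈ F with hVdef
    have hV : {x | cayleyPoint d t x ∈ F} = (V : Set ((i : Fin r) × Fin (n i))) := by
      simp [hVdef]
    rw [hV] at hF
    have hmeets : MeetsAll V := by
      rwa [← convexHull_inter_avgFlat_nonempty_iff (d := d) (t := t) hr, ← hF]
    have hrV := hmeets.le_card
    refine ⟨V, ⟨hmeets, ?_⟩, hF.symm⟩
    rw [hF, faceDim_convexHull_image] at hdim
    refine le_antisymm ?_ ?_
    · by_contra! hlt
      -- Here the extra point allowed in affine independence is used: `k + 1` independent vertices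
      -- would force dimension at least `k`.
      obtain ⟨T, hTV, hT, hTcard⟩ := exists_subset_meetsAll hmeets (m := k + 1) (by omega) hlt
      have h1 := finrank_vectorSpan_of_meetsAll hrd ht hsep hT (by omega) (by omega)
      have h2 : vectorSpan ℝ (Set.range fun x : T => cayleyPoint d t x) ≤
          vectorSpan ℝ (Set.range fun x : V => cayleyPoint d t x) := by
        refine vectorSpan_mono ℝ ?_
        rintro _ ⟨x, rfl⟩
        exact ⟨⟨x, hTV x.2⟩, rfl⟩
      have h3 := Submodule.finrank_mono h2
      omega
    · have := finrank_vectorSpan_range_le ℝ (fun x : V => cayleyPoint d t x) (n := V.card - 1)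
        (by rw [Fintype.card_coe]; omega)
      omega
  · rintro ⟨T, ⟨hT, hcard⟩, rfl⟩
    refine ⟨⟨isFace_convexHull_of_meetsAll hr hrd ht hsep hT (by omega),
      (convexHull_inter_avgFlat_nonempty_iff hr T).2 hT⟩, ?_⟩
    rw [faceDim_convexHull_image, finrank_vectorSpan_of_meetsAll hrd ht hsep hT (by omega)
      (by omega), hcard]

end Separated

/-! ### Counting spanning sets -/

/-- A spanning set is a family of nonempty subsets, one per block; sorting the families by their
sizes `s_i` gives the products of binomials. -/
theorem encard_meetsAll {r : ℕ} (n : Fin r → ℕ) (k : ℕ) :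
    {T : Finset ((i : Fin r) × Fin (n i)) | MeetsAll T ∧ T.card = k}.encard =
      (spanCount n k : ℕ∞) := by
  classical
  let A := (Fintype.piFinset fun i : Fin r =>
    (Finset.univ : Finset (Finset (Fin (n i)))).filter Finset.Nonempty).filter
      fun B => ∑ i, (B i).card = k
  have himage : {T : Finset ((i : Fin r) × Fin (n i)) | MeetsAll T ∧ T.card = k} =
      (fun B => Finset.univ.sigma B) '' (A : Set ((i : Fin r) → Finset (Fin (n i)))) := by
    ext T
    constructor
    · rintro ⟨hT, hcard⟩
      have hsigma : Finset.univ.sigma (fun i : Fin r =>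
          (Finset.univ : Finset (Fin (n i))).filter fun j => ⟨i, j⟩ ∈ T) = T := by
        ext ⟨i, j⟩
        simp
      refine ⟨_, ?_, hsigma⟩
      rw [← hsigma, Finset.card_sigma] at hcard
      simp only [A, Finset.coe_filter, Fintype.mem_piFinset, Finset.mem_filter, Finset.mem_univ,
        true_and, Set.mem_ofPred_eq]
      refine ⟨fun i => ?_, hcard⟩
      obtain ⟨j, hj⟩ := hT i
      exact ⟨j, by simpa using hj⟩
    · rintro ⟨B, hB, rfl⟩
      simp only [A, Finset.coe_filter, Fintype.mem_piFinset, Finset.mem_filter, Finset.mem_univ,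
        true_and, Set.mem_ofPred_eq] at hB
      refine ⟨fun i => ?_, by rw [Finset.card_sigma, hB.2]⟩
      obtain ⟨j, hj⟩ := hB.1 i
      exact ⟨j, by simpa using hj⟩
  have hinj : Function.Injective
      fun B : (i : Fin r) → Finset (Fin (n i)) => Finset.univ.sigma B := by
    intro B B' h
    funext i
    ext j
    simpa using Finset.ext_iff.1 h ⟨i, j⟩
  rw [himage, hinj.encard_image, Set.encard_coe_eq_coe_finsetCard, Nat.cast_inj, spanCount]
  rw [Finset.card_eq_sum_card_fiberwise (f := fun B i => (B i).card)
    (t := (Fintype.piFinset fun i => Finset.Icc 1 (n i)).filter fun s => ∑ i, s i = k)]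
  · refine Finset.sum_congr rfl fun s hs => ?_
    simp only [Finset.mem_filter, Fintype.mem_piFinset, Finset.mem_Icc] at hs
    have : A.filter (fun B => (fun i => (B i).card) = s) =
        Fintype.piFinset fun i => Finset.powersetCard (s i) Finset.univ := by
      ext B
      simp only [A, Finset.mem_filter, Fintype.mem_piFinset, Finset.mem_univ, true_and,
        Finset.mem_powersetCard, Finset.subset_univ]
      constructor
      · rintro ⟨-, rfl⟩ i
        rfl
      · intro h
        refine ⟨⟨fun i => Finset.card_pos.1 (by have := h i; have := hs.1 i; omega), ?_⟩, funext h⟩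
        simp only [h, hs.2]
    rw [this, Fintype.card_piFinset]
    simp
  · intro B hB
    simp only [A, Finset.coe_filter, Fintype.mem_piFinset, Finset.mem_filter, Finset.mem_univ,
      true_and, Set.mem_ofPred_eq, Finset.mem_Icc] at hB ⊢
    exact ⟨fun i => ⟨(hB.1 i).card_pos, (Finset.card_le_univ _).trans_eq (Fintype.card_fin _)⟩, hB.2⟩

/-! ### Separation for small `τ`, and the theorem -/

/-- The quotient of the two sides is a constant times a positive power of `τ`, and only finitely
many pairs occur. The bound on `τ` does not involve `k`. -/
theorem exists_pos_forall_scaled_lt {r : ℕ} (n : Fin r → ℕ) (α : (i : Fin r) → Fin (n i) → ℝ)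
    (hα : ∀ i j, 0 < α i j) (ν : Fin r → ℕ) (hν : StrictAnti ν) :
    ∃ τ₀ : ℝ, 0 < τ₀ ∧ ∀ τ : ℝ, 0 < τ → τ ≤ τ₀ →
      ∀ i i', i < i' → ∀ j j', α i j * τ ^ ν i < α i' j' * τ ^ ν i' := by
  have hev : ∀ᶠ τ : ℝ in nhdsWithin 0 (Set.Ioi 0), ∀ (x y : (i : Fin r) × Fin (n i)), x.1 < y.1 →
      α x.1 x.2 * τ ^ ν x.1 < α y.1 y.2 * τ ^ ν y.1 := by
    rw [Filter.eventually_all]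
    intro x
    rw [Filter.eventually_all]
    intro y
    rw [Filter.eventually_imp_distrib_left]
    intro hxy
    obtain ⟨e, he⟩ := Nat.exists_eq_add_of_lt (hν hxy)
    have hlim : Filter.Tendsto (fun τ : ℝ => α x.1 x.2 * τ ^ (e + 1)) (nhdsWithin 0 (Set.Ioi 0))
        (nhds 0) := by
      have : Continuous fun τ : ℝ => α x.1 x.2 * τ ^ (e + 1) := by fun_prop
      simpa using (this.tendsto 0).mono_left nhdsWithin_le_nhds
    filter_upwards [hlim.eventually_lt_const (hα y.1 y.2), self_mem_nhdsWithin] with τ h1 hτ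
    rw [he, add_assoc, add_comm, pow_add, ← mul_assoc]
    exact mul_lt_mul_of_pos_right h1 (pow_pos hτ _)
  obtain ⟨τ₀, hτ₀, h⟩ := mem_nhdsGT_iff_exists_Ioc_subset.1 hev
  exact ⟨τ₀, hτ₀, fun τ h0 h1 i i' hi j j' => h ⟨h0, h1⟩ ⟨i, j⟩ ⟨i', j'⟩ hi⟩

theorem cayleyEmbedding_cyclicPoints {r : ℕ} (d : ℕ) (n : Fin r → ℕ)
    (α : (i : Fin r) → Fin (n i) → ℝ) (ν : Fin r → ℕ) (τ : ℝ) :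
    cayleyEmbedding (cyclicPoints d n α ν τ) =
      Set.range (cayleyPoint d fun i j => α i j * τ ^ ν i) := by
  ext z
  simp [cayleyEmbedding, cyclicPoints, cayleyPoint, Sigma.exists]

theorem IsSpanning.exists_finset {r d : ℕ} {n : Fin r → ℕ}
    {α : (i : Fin r) → Fin (n i) → ℝ} {ν : Fin r → ℕ} {τ : ℝ} {S : Set (Ambient r d)}
    (hS : IsSpanning (cyclicPoints d n α ν τ) S) :
    ∃ T : Finset ((i : Fin r) × Fin (n i)), MeetsAll T ∧
      S = cayleyPoint d (fun i j => α i j * τ ^ ν i) '' (T : Set ((i : Fin r) × Fin (n i))) := by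
  classical
  refine ⟨Finset.univ.filter fun x => cayleyPoint d (fun i j => α i j * τ ^ ν i) x ∈ S,
    fun i => ?_, ?_⟩
  · obtain ⟨_, hS', _, ⟨j, rfl⟩, rfl⟩ := hS.2 i
    exact ⟨j, Finset.mem_filter.2 ⟨Finset.mem_univ _, hS'⟩⟩
  · have := hS.1
    rw [cayleyEmbedding_cyclicPoints] at this
    simp only [Finset.coe_filter, Finset.mem_univ, true_and]
    exact (Set.image_preimage_eq_of_subset this).symm

end CayleySum

theorem lemma3 (d r : ℕ) (hd : 3 ≤ d) (hr : 2 ≤ r) (hrd : r ≤ d - 1)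
    (n : Fin r → ℕ) (hn : ∀ i, 1 ≤ n i)
    (α : (i : Fin r) → Fin (n i) → ℝ) (hα : ∀ i j, 0 < α i j) (hαm : ∀ i, StrictMono (α i))
    (ν : Fin r → ℕ) (hν : StrictAnti ν) (hν0 : ∀ i : Fin r, (i : ℕ) + 1 = r → ν i = 0) :
    ∃ τ₀ : ℝ, 0 < τ₀ ∧ ∀ τ : ℝ, 0 < τ → τ ≤ τ₀ →
      ∀ k : ℕ, r ≤ k → k ≤ (d + r - 1) / 2 →
        (∀ S : Set (CayleySum.Ambient r d),
          CayleySum.IsSpanning (CayleySum.cyclicPoints d n α ν τ) S → S.encard = k →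
          ∃ F : Set (CayleySum.Ambient r d),
            CayleySum.IsFace
                (CayleySum.cayleyPolytope (CayleySum.cyclicPoints d n α ν τ)) F ∧
              CayleySum.faceDim F = k - 1 ∧ CayleySum.vertexSet F = S) ∧
        CayleySum.faceNumber
            (CayleySum.flatFaces
              (CayleySum.cayleyPolytope (CayleySum.cyclicPoints d n α ν τ))) (k - 1) =
          (CayleySum.spanCount n k : ℕ∞) := by
  obtain ⟨τ₀, hτ₀, h⟩ := CayleySum.exists_pos_forall_scaled_lt n α hα ν hν
  refine ⟨τ₀, hτ₀, fun τ hτ hττ₀ k hrk hk => ?_⟩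
  have hsep := h τ hτ hττ₀
  have ht : ∀ i, StrictMono fun j => α i j * τ ^ ν i := fun i j j' hj =>
    mul_lt_mul_of_pos_right (hαm i hj) (pow_pos hτ _)
  have hrd' : r ≤ d := by omega
  have hinj := CayleySum.cayleyPoint_injective hrd' ht
  rw [CayleySum.cayleyPolytope, CayleySum.cayleyEmbedding_cyclicPoints]
  constructor
  · intro S hS hcard
    obtain ⟨T, hT, rfl⟩ := hS.exists_finset
    rw [hinj.encard_image, Set.encard_coe_eq_coe_finsetCard, Nat.cast_inj] at hcard
    refine ⟨_, CayleySum.isFace_convexHull_of_meetsAll (by omega) hrd' ht hsep hT (by omega), ?_,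
      CayleySum.vertexSet_convexHull_of_meetsAll hrd' ht hsep hT (by omega)⟩
    rw [CayleySum.faceDim_convexHull_image, CayleySum.finrank_vectorSpan_of_meetsAll hrd' ht hsep hT
      (by omega) (by omega), hcard]
  · rw [CayleySum.faceNumber,
      CayleySum.setOf_flatFaces_eq_image (by omega) hrd' ht hsep hrk (by omega),
      Set.InjOn.encard_image, CayleySum.encard_meetsAll]
    rintro T ⟨hT, hcard⟩ T' ⟨hT', hcard'⟩ hTT'
    -- A spanning set is recovered from its face as the vertex set.
    have := congrArg CayleySum.vertexSet hTT'
    simp only at this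
    rw [CayleySum.vertexSet_convexHull_of_meetsAll hrd' ht hsep hT (by omega),
      CayleySum.vertexSet_convexHull_of_meetsAll hrd' ht hsep hT' (by omega)] at this
    exact Finset.coe_injective (hinj.image_injective this)
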